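/- Let $m \ge 1$. An affine manifold of dimension $m$ is a (Hausdorff) topological manifold $M$ together with an affine structure, i.e. a (maximal) atlas of charts with values in open subsets of $\mathbb{R}^m$ all of whose transition functions are affine, that is, locally (on each connected component of the overlap) of the form $x \mapsto Ax + b$ with $A \in \mathrm{GL}(m,\mathbb{R})$ and $b \in \mathbb{R}^m$. If $M$ is a connected affine manifold of dimension $m$ whose fundamental group is finite, then $M$ is not compact. -/

import Mathlib

open scoped Topology

/-- The pseudogroup of affine diffeomorphisms between open subsets of `ℝ^m`: open partial
homeomorphisms that near every point of their source have the form `x ↦ A x + b` with `A` an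
invertible linear map. On a disconnected source (for instance a disconnected overlap of two charts)
`A` and `b` may depend on the connected component. -/
def affineGroupoid (m : ℕ) : StructureGroupoid (EuclideanSpace ℝ (Fin m)) where
  members := {e | ∀ x ∈ e.source,
    ∃ φ : EuclideanSpace ℝ (Fin m) ≃ᵃ[ℝ] EuclideanSpace ℝ (Fin m), ∀ᶠ y in 𝓝 x, e y = φ y}
  trans' e e' he he' x hx := by
    rw [OpenPartialHomeomorph.trans_source] at hx
    obtain ⟨φ, hφ⟩ := he x hx.1
    obtain ⟨ψ, hψ⟩ := he' (e x) hx.2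
    refine ⟨φ.trans ψ, ?_⟩
    filter_upwards [hφ, (e.continuousAt hx.1).eventually hψ] with y hy hy'
    simp only [OpenPartialHomeomorph.coe_trans, Function.comp_apply, AffineEquiv.coe_trans]
    rw [hy', hy]
  symm' e he x hx := by
    obtain ⟨φ, hφ⟩ := he (e.symm x) (e.map_target hx)
    refine ⟨φ.symm, ?_⟩
    filter_upwards [(e.symm.continuousAt hx).eventually hφ, e.open_target.mem_nhds hx] with y hy hy'
    rw [e.right_inv hy'] at hy
    rw [hy, AffineEquiv.symm_apply_apply, ← hy]
  id_mem' x _ := ⟨AffineEquiv.refl ℝ _, Filter.Eventually.of_forall fun _ => rfl⟩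
  locality' e he x hx := by
    obtain ⟨s, hs, hxs, h⟩ := he x hx
    exact h x (by rw [e.restr_source, hs.interior_eq]; exact ⟨hx, hxs⟩)
  mem_of_eqOnSource' e e' he hee' x hx := by
    obtain ⟨φ, hφ⟩ := he x (hee'.1 ▸ hx)
    refine ⟨φ, ?_⟩
    filter_upwards [hφ, e'.open_source.mem_nhds hx] with y hy hy'
    rw [hee'.2 hy', hy]

/-- `M` is an affine manifold of dimension `m`: a Hausdorff space with an atlas of charts in `ℝ^m`
all of whose transition maps are affine. The affine structure is the maximal affine atlas
`(affineGroupoid m).maximalAtlas M` generated by it. -/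
class IsAffineManifold (m : ℕ) (M : Type*) [TopologicalSpace M]
    [ChartedSpace (EuclideanSpace ℝ (Fin m)) M] : Prop extends
    T2Space M, HasGroupoid M (affineGroupoid m)

/-! Germs of affine coordinate systems form a covering space of `M` with discrete fibre the affine
group, because an affine map is determined by its restriction to a nonempty open set. Evaluating a
germ at its base point is the developing map into `ℝ^m`, which is continuous and open. Let `C` be a
path component of this covering; it stands in for the universal cover. `C` is open, and its fibres
are finite because monodromy reaches them from homotopy classes of paths in `M`. So if `M` were
compact, `C` would be too (`IsCoveringMap.isCompact_pathComponent`). Its image would then be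
nonempty, compact and open, hence all of the noncompact space `ℝ^m`. -/

open Filter Set Bundle

/-! ### Path components of covering spaces -/

section Covering

variable {E X F : Type*} [TopologicalSpace E] [TopologicalSpace X] [TopologicalSpace F] {p : E → X}

/-- Two points on the same sheet of a trivialization over a path-connected set are joined. -/
theorem Bundle.Trivialization.joined_of_snd_eq (t : Trivialization F p) {V : Set X}
    (hV : IsPathConnected V) (hVt : V ⊆ t.baseSet) {e e' : E} (he : p e ∈ V) (he' : p e' ∈ V)
    (h : (t e).2 = (t e').2) : Joined e e' := by
  obtain ⟨γ, hγ⟩ := hV.joinedIn _ he _ he'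
  have hcont : ContinuousOn (fun y => t.toPartialEquiv.symm (y, (t e).2)) (range γ) := by
    refine t.continuousOn_invFun.comp (by fun_prop) ?_
    rintro _ ⟨s, rfl⟩
    exact t.mem_target.2 (hVt (hγ s))
  refine ⟨(γ.map' hcont).cast ?_ ?_⟩
  · exact (t.symm_apply_mk_proj (t.mem_source.2 (hVt he))).symm
  · rw [h]
    exact (t.symm_apply_mk_proj (t.mem_source.2 (hVt he'))).symm

/-- Over a locally path-connected base, path components of a covering space are open. -/
theorem IsCoveringMap.isOpen_pathComponent [LocallyPathConnectedSpace X] (cov : IsCoveringMap p)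
    (e₀ : E) : IsOpen (pathComponent e₀) := by
  refine isOpen_iff_mem_nhds.2 fun e he => ?_
  have := (cov (p e)).1
  have : Nonempty (p ⁻¹' {p e}) := ⟨⟨e, rfl⟩⟩
  let t := (cov (p e)).toTrivialization
  have hbase : p e ∈ t.baseSet := (cov (p e)).mem_toTrivialization_baseSet
  obtain ⟨V, ⟨hVn, hV⟩, hVt⟩ := (path_connected_basis (p e)).mem_iff.1
    (t.open_baseSet.mem_nhds hbase)
  have hsnd : ContinuousAt (fun e' => (t e').2) e :=
    (t.continuousAt (t.mem_source.2 hbase)).snd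
  filter_upwards [cov.continuous.continuousAt.preimage_mem_nhds hVn,
    hsnd.preimage_mem_nhds ((isOpen_discrete {(t e).2}).mem_nhds rfl)] with e' h₁ h₂
  exact he.trans (t.joined_of_snd_eq hV hVt (mem_of_mem_nhds hVn) h₁ (Eq.symm h₂))

theorem Path.Homotopic.finite_quotient_of_finite_fundamentalGroup (x y : X)
    [Finite (FundamentalGroup X x)] : Finite (Path.Homotopic.Quotient x y) := by
  rcases isEmpty_or_nonempty (Path.Homotopic.Quotient x y) with _ | hne
  · infer_instance
  · obtain ⟨γ₀⟩ := hne
    have : Finite (Path.Homotopic.Quotient x x) := ‹Finite (FundamentalGroup X x)›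
    -- Closing up with a fixed `γ₀` turns paths into loops, and appending `γ₀` again undoes this.
    refine Finite.of_injective (fun γ : Path.Homotopic.Quotient x y => γ.trans γ₀.symm) ?_
    intro γ γ' h
    have h' := congrArg (fun δ => δ.trans γ₀) (h : γ.trans γ₀.symm = γ'.trans γ₀.symm)
    simpa only [Path.Homotopic.Quotient.trans_assoc, Path.Homotopic.Quotient.symm_trans,
      Path.Homotopic.Quotient.trans_refl] using h'

/-- A path component of a covering space meets each fibre in a finite set when the fundamental
group of the base is finite. -/
theorem IsCoveringMap.finite_pathComponent_inter_fiber (cov : IsCoveringMap p) (e₀ : E)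
    [Finite (FundamentalGroup X (p e₀))] (x : X) : (pathComponent e₀ ∩ p ⁻¹' {x}).Finite := by
  have := Path.Homotopic.finite_quotient_of_finite_fundamentalGroup (p e₀) x
  refine (finite_range fun γ : Path.Homotopic.Quotient (p e₀) x =>
    (cov.monodromy γ ⟨e₀, rfl⟩ : E)).subset ?_
  rintro e ⟨⟨γ⟩, rfl⟩
  -- A path from `e₀` to `e` is the lift of its own projection, so monodromy along that projection
  -- ends at `e`.
  exact ⟨Path.Homotopic.Quotient.map (.mk γ) ⟨p, cov.continuous⟩,
    congrArg Subtype.val (cov.monodromy_map (.mk γ))⟩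

/-- Path components of a covering space of a compact space with finite fundamental group are
compact. -/
theorem IsCoveringMap.isCompact_pathComponent [LocallyPathConnectedSpace X] [CompactSpace X]
    (cov : IsCoveringMap p) (hp : Function.Surjective p) (e₀ : E)
    [Finite (FundamentalGroup X (p e₀))] : IsCompact (pathComponent e₀) := by
  refine isCompact_iff_ultrafilter_le_nhds'.2 fun f hf => ?_
  obtain ⟨x, -, hx⟩ := isCompact_univ.ultrafilter_le_nhds (f.map p) (by simp)
  replace hx : Tendsto p f (𝓝 x) := hx
  have := (cov x).1
  have : Nonempty (p ⁻¹' {x}) := let ⟨e, he⟩ := hp x; ⟨⟨e, he⟩⟩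
  let t := (cov x).toTrivialization
  have hbase : x ∈ t.baseSet := (cov x).mem_toTrivialization_baseSet
  obtain ⟨V, ⟨hVn, hV⟩, hVt⟩ := (path_connected_basis x).mem_iff.1
    (t.open_baseSet.mem_nhds hbase)
  have hxV : x ∈ V := mem_of_mem_nhds hVn
  -- Sliding `e` along its sheet to the fibre over `x` stays in the path component, so only finitely
  -- many sheets occur and the ultrafilter `f` selects one.
  have key : (⋃ c ∈ pathComponent e₀ ∩ p ⁻¹' {x}, {e | p e ∈ V ∧ (t e).2 = (t c).2}) ∈ f := by
    filter_upwards [hf, hx.eventually hVn] with e he heV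
    have hmem : (x, (t e).2) ∈ t.target := t.mem_target.2 hbase
    have hpc : p (t.toPartialEquiv.symm (x, (t e).2)) = x := t.proj_symm_apply hmem
    have htc : (t (t.toPartialEquiv.symm (x, (t e).2))).2 = (t e).2 :=
      (congrArg Prod.snd (t.apply_symm_apply hmem) :)
    refine mem_biUnion (x := t.toPartialEquiv.symm (x, (t e).2)) ⟨?_, hpc⟩ ⟨heV, htc.symm⟩
    exact he.trans (t.joined_of_snd_eq hV hVt heV (by rwa [hpc]) htc.symm)
  obtain ⟨c, ⟨hc, hcx⟩, hfc⟩ := (Ultrafilter.finite_biUnion_mem_iff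
    (cov.finite_pathComponent_inter_fiber e₀ x)).1 key
  refine ⟨c, hc, ?_⟩
  have hcs : c ∈ t.source := t.mem_source.2 (by rw [show p c = x from hcx]; exact hbase)
  -- On the selected sheet `e` is recovered continuously from `p e`, so convergence in the base
  -- lifts to `c`.
  have hlim : Tendsto (fun e => t.toPartialEquiv.symm (p e, (t c).2)) f (𝓝 c) := by
    have h : ContinuousAt t.toOpenPartialHomeomorph.symm (t c) :=
      t.toOpenPartialHomeomorph.continuousAt_symm (t.toOpenPartialHomeomorph.map_source hcs)
    have h' : Tendsto (fun e => (p e, (t c).2)) f (𝓝 (t c)) := by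
      rw [← t.mk_proj_snd hcs, show p c = x from hcx]
      exact hx.prodMk_nhds tendsto_const_nhds
    have := h.tendsto.comp h'
    rwa [show t.toOpenPartialHomeomorph.symm (t c) = c from
      t.toOpenPartialHomeomorph.left_inv hcs] at this
  refine tendsto_id'.1 (hlim.congr' ?_)
  filter_upwards [hfc] with e he
  rw [← he.2]
  exact t.symm_apply_mk_proj (t.mem_source.2 (hVt he.1))

end Covering

/-! ### Germs of affine coordinates and the developing map -/

section AffineManifold

variable {m : ℕ} {M : Type*} [TopologicalSpace M]

/-- The discrete topology on affine automorphisms, which serve as the fibre of a covering space. -/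
instance : TopologicalSpace (EuclideanSpace ℝ (Fin m) ≃ᵃ[ℝ] EuclideanSpace ℝ (Fin m)) := ⊥

instance : DiscreteTopology (EuclideanSpace ℝ (Fin m) ≃ᵃ[ℝ] EuclideanSpace ℝ (Fin m)) := ⟨rfl⟩

/-- A nonempty open set affinely spans `ℝ^m`. This rigidity makes transitions unique, hence cocyclic
and locally constant. -/
theorem AffineEquiv.eq_of_eventuallyEq_comp_chart
    {c : OpenPartialHomeomorph M (EuclideanSpace ℝ (Fin m))} {x : M} (hx : x ∈ c.source)
    {φ ψ : EuclideanSpace ℝ (Fin m) ≃ᵃ[ℝ] EuclideanSpace ℝ (Fin m)}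
    (h : ∀ᶠ y in 𝓝 x, φ (c y) = ψ (c y)) : φ = ψ := by
  have h' : ∀ᶠ z in 𝓝 (c x), φ z = ψ z := by
    rw [← c.map_nhds_eq hx]
    exact h
  obtain ⟨u, hu, huo, hxu⟩ := eventually_nhds_iff.1 h'
  exact AffineEquiv.ext_on (huo.affineSpan_eq_top ⟨_, hxu⟩) φ ψ hu

variable [ChartedSpace (EuclideanSpace ℝ (Fin m)) M]

variable (m M) in
/-- Any two charts of an affine manifold differ by an affine automorphism near a common point. -/
theorem exists_eventually_chart_eq_affineEquiv [HasGroupoid M (affineGroupoid m)]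
    (i j : atlas (EuclideanSpace ℝ (Fin m)) M) (x : M) (hi : x ∈ i.1.source)
    (hj : x ∈ j.1.source) :
    ∃ φ : EuclideanSpace ℝ (Fin m) ≃ᵃ[ℝ] EuclideanSpace ℝ (Fin m),
      ∀ᶠ y in 𝓝 x, φ (j.1 y) = i.1 y := by
  obtain ⟨φ, hφ⟩ : ∃ φ : EuclideanSpace ℝ (Fin m) ≃ᵃ[ℝ] EuclideanSpace ℝ (Fin m),
      ∀ᶠ z in 𝓝 (j.1 x), (j.1.symm.trans i.1) z = φ z :=
    HasGroupoid.compatible (G := affineGroupoid m) j.2 i.2 (j.1 x) (by simp [hi, hj])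
  refine ⟨φ, ?_⟩
  filter_upwards [(j.1.continuousAt hj).eventually hφ, j.1.open_source.mem_nhds hj] with y hy hyj
  rw [← hy]
  simp [j.1.left_inv hyj]

open Classical in
/-- The affine automorphism turning the chart `j` into the chart `i` near `x`. -/
noncomputable def affineTransition (i j : atlas (EuclideanSpace ℝ (Fin m)) M) (x : M) :
    EuclideanSpace ℝ (Fin m) ≃ᵃ[ℝ] EuclideanSpace ℝ (Fin m) :=
  if h : ∃ φ : EuclideanSpace ℝ (Fin m) ≃ᵃ[ℝ] EuclideanSpace ℝ (Fin m),
      ∀ᶠ y in 𝓝 x, φ (j.1 y) = i.1 y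
  then h.choose else AffineEquiv.refl ℝ _

variable [HasGroupoid M (affineGroupoid m)] {i j k : atlas (EuclideanSpace ℝ (Fin m)) M} {x : M}

theorem eventually_affineTransition (hi : x ∈ i.1.source) (hj : x ∈ j.1.source) :
    ∀ᶠ y in 𝓝 x, affineTransition i j x (j.1 y) = i.1 y := by
  have h := exists_eventually_chart_eq_affineEquiv m M i j x hi hj
  rw [affineTransition, dif_pos h]
  exact h.choose_spec

theorem affineTransition_self (hi : x ∈ i.1.source) :
    affineTransition i i x = AffineEquiv.refl ℝ _ :=
  AffineEquiv.eq_of_eventuallyEq_comp_chart hi (eventually_affineTransition hi hi)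

theorem affineTransition_trans (hi : x ∈ i.1.source) (hj : x ∈ j.1.source) (hk : x ∈ k.1.source) :
    (affineTransition j k x).trans (affineTransition i j x) = affineTransition i k x := by
  refine AffineEquiv.eq_of_eventuallyEq_comp_chart hk ?_
  filter_upwards [eventually_affineTransition hi hj, eventually_affineTransition hj hk,
    eventually_affineTransition hi hk] with y h₁ h₂ h₃
  rw [AffineEquiv.trans_apply, h₂, h₁, h₃]

theorem eventually_affineTransition_eq (hi : x ∈ i.1.source) (hj : x ∈ j.1.source) :
    ∀ᶠ y in 𝓝 x, affineTransition i j y = affineTransition i j x := by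
  filter_upwards [(eventually_affineTransition hi hj).eventually_nhds,
    i.1.open_source.mem_nhds hi, j.1.open_source.mem_nhds hj] with y hy hyi hyj
  refine AffineEquiv.eq_of_eventuallyEq_comp_chart hyj ?_
  filter_upwards [hy, eventually_affineTransition hyi hyj] with z h₁ h₂
  rw [h₁, h₂]

variable (m M) in
/-- The covering space of germs of affine coordinate systems: over `x`, the automorphism `A`
read in the chart `c` stands for the germ of `A ∘ c` at `x`. -/
noncomputable def affineGermCore :
    FiberBundleCore (atlas (EuclideanSpace ℝ (Fin m)) M) M
      (EuclideanSpace ℝ (Fin m) ≃ᵃ[ℝ] EuclideanSpace ℝ (Fin m)) where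
  baseSet i := i.1.source
  isOpen_baseSet i := i.1.open_source
  indexAt x := ⟨chartAt _ x, chart_mem_atlas _ x⟩
  mem_baseSet_at x := mem_chart_source _ x
  -- Near `x`, `A ∘ i = A ∘ affineTransition i j x ∘ j`.
  coordChange i j x A := (affineTransition i j x).trans A
  coordChange_self i x hx A := by
    rw [affineTransition_self hx]
    rfl
  continuousOn_coordChange i j := by
    rintro ⟨x, A⟩ ⟨⟨hi, hj⟩, -⟩
    refine ContinuousAt.continuousWithinAt ?_
    refine (continuousAt_const (y := (affineTransition i j x).trans A)).congr ?_
    filter_upwards [continuousAt_fst.eventually (eventually_affineTransition_eq hi hj),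
      continuousAt_snd.preimage_mem_nhds ((isOpen_discrete {A}).mem_nhds rfl)] with q hq hA
    rw [hq, show q.2 = A from hA]
  coordChange_comp i j k x hx A := by
    rw [← affineTransition_trans hx.1.1 hx.1.2 hx.2]
    rfl

variable (m M) in
theorem isCoveringMap_affineGermCore_proj : IsCoveringMap (affineGermCore m M).proj :=
  FiberBundle.isCoveringMap

/-- The developing map: evaluation of a germ of affine coordinates at its base point. -/
noncomputable def developingMap (e : (affineGermCore m M).TotalSpace) : EuclideanSpace ℝ (Fin m) :=
  (show EuclideanSpace ℝ (Fin m) ≃ᵃ[ℝ] EuclideanSpace ℝ (Fin m) from e.2) (chartAt _ e.1 e.1)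

/-- The value of a germ at its base point does not depend on the chart in which it is read, so any
convenient chart may be used. -/
theorem developingMap_eq_localTriv {e : (affineGermCore m M).TotalSpace} (he : e.1 ∈ i.1.source) :
    developingMap e = ((affineGermCore m M).localTriv i e).2 (i.1 e.1) :=
  (congrArg (show EuclideanSpace ℝ (Fin m) ≃ᵃ[ℝ] EuclideanSpace ℝ (Fin m) from e.2)
    (eventually_affineTransition (i := ⟨chartAt _ e.1, chart_mem_atlas _ e.1⟩)
      (mem_chart_source _ e.1) he).self_of_nhds).symm

theorem continuous_developingMap :
    Continuous (developingMap : (affineGermCore m M).TotalSpace → _) := by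
  refine continuous_iff_continuousAt.2 fun e => ?_
  let i : atlas (EuclideanSpace ℝ (Fin m)) M := ⟨chartAt _ e.1, chart_mem_atlas _ e.1⟩
  let t := (affineGermCore m M).localTriv i
  have hes : e ∈ t.source := mem_chart_source _ e.1
  have hev : developingMap =ᶠ[𝓝 e] fun e' => (t e').2 (i.1 (t e').1) := by
    filter_upwards [t.open_source.mem_nhds hes] with e' he'
    exact developingMap_eq_localTriv he'
  have hc : ContinuousAt (fun q : M × (EuclideanSpace ℝ (Fin m) ≃ᵃ[ℝ] EuclideanSpace ℝ (Fin m)) =>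
      q.2 (i.1 q.1)) (t e) := by
    have h : ContinuousAt (fun q : M × (EuclideanSpace ℝ (Fin m) ≃ᵃ[ℝ] EuclideanSpace ℝ (Fin m)) =>
        (t e).2 (i.1 q.1)) (t e) := by
      refine (t e).2.continuous_of_finiteDimensional.continuousAt.comp ?_
      have hi : ContinuousAt i.1 (t e).1 := i.1.continuousAt (mem_chart_source _ e.1)
      exact hi.comp continuousAt_fst
    refine h.congr ?_
    filter_upwards [continuousAt_snd.preimage_mem_nhds ((isOpen_discrete {(t e).2}).mem_nhds rfl)]
      with q hq
    rw [show q.2 = (t e).2 from hq]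
  exact (hc.comp (t.continuousAt hes)).congr hev.symm

/-- Along the local section `s` of constant coordinate `A`, the developing map is `A ∘ i`, which
carries neighbourhoods to neighbourhoods. -/
theorem isOpenMap_developingMap :
    IsOpenMap (developingMap : (affineGermCore m M).TotalSpace → _) := by
  refine IsOpenMap.of_nhds_le fun e => ?_
  let i : atlas (EuclideanSpace ℝ (Fin m)) M := ⟨chartAt _ e.1, chart_mem_atlas _ e.1⟩
  let t := (affineGermCore m M).localTriv i
  have hes : e ∈ t.source := mem_chart_source _ e.1
  have hi : e.1 ∈ i.1.source := mem_chart_source _ e.1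
  let A : EuclideanSpace ℝ (Fin m) ≃ᵃ[ℝ] EuclideanSpace ℝ (Fin m) := (t e).2
  let s : M → (affineGermCore m M).TotalSpace := fun y => t.toOpenPartialHomeomorph.symm (y, A)
  have hs : Tendsto s (𝓝 e.1) (𝓝 e) := by
    have h : ContinuousAt t.toOpenPartialHomeomorph.symm (t e) :=
      t.toOpenPartialHomeomorph.continuousAt_symm (t.toOpenPartialHomeomorph.map_source hes)
    have h' : Tendsto (fun y : M => (y, A)) (𝓝 e.1) (𝓝 (t e)) :=
      (continuous_id.prodMk continuous_const).continuousAt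
    have := h.tendsto.comp h'
    rwa [show t.toOpenPartialHomeomorph.symm (t e) = e from
      t.toOpenPartialHomeomorph.left_inv hes] at this
  have hdev : (developingMap ∘ s) =ᶠ[𝓝 e.1] (A ∘ i.1) := by
    filter_upwards [i.1.open_source.mem_nhds hi] with y hy
    have hmem : (y, A) ∈ t.target := t.mem_target.2 hy
    have hts : t (s y) = (y, A) := t.apply_symm_apply hmem
    refine (developingMap_eq_localTriv (i := i) (e := s y) hy).trans ?_
    change (t (s y)).2 (i.1 y) = A (i.1 y)
    rw [hts]
  calc 𝓝 (developingMap e) = 𝓝 (A (i.1 e.1)) := by rw [developingMap_eq_localTriv hi]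
    _ = map (A ∘ i.1) (𝓝 e.1) := by
      rw [← Filter.map_map, i.1.map_nhds_eq hi]
      exact (A.toContinuousAffineEquiv.toHomeomorph.map_nhds_eq _).symm
    _ = map developingMap (map s (𝓝 e.1)) := by rw [Filter.map_map, map_congr hdev]
    _ ≤ map developingMap (𝓝 e) := map_mono hs

end AffineManifold

theorem mainTheorem11 {m : ℕ} (hm : 1 ≤ m) {M : Type*} [TopologicalSpace M]
    [ChartedSpace (EuclideanSpace ℝ (Fin m)) M] [IsAffineManifold m M] [ConnectedSpace M]
    (x : M) (hfin : Finite (FundamentalGroup M x)) :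
    ¬ CompactSpace M := by
  intro hM
  have : LocallyPathConnectedSpace M :=
    ChartedSpace.locallyPathConnectedSpace (EuclideanSpace ℝ (Fin m)) M
  -- For `m = 0` the model space is a point; `1 ≤ m` makes it noncompact.
  have : Nonempty (Fin m) := ⟨⟨0, hm⟩⟩
  have cov := isCoveringMap_affineGermCore_proj m M
  let e₀ : (affineGermCore m M).TotalSpace := ⟨x, AffineEquiv.refl ℝ _⟩
  have : Finite (FundamentalGroup M ((affineGermCore m M).proj e₀)) := hfin
  have hcompact : IsCompact (developingMap '' pathComponent e₀) :=
    (cov.isCompact_pathComponent (fun y => ⟨⟨y, AffineEquiv.refl ℝ _⟩, rfl⟩) e₀).image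
      continuous_developingMap
  have hopen : IsOpen (developingMap '' pathComponent e₀) :=
    isOpenMap_developingMap _ (cov.isOpen_pathComponent e₀)
  have huniv := IsClopen.eq_univ ⟨hcompact.isClosed, hopen⟩
    ⟨_, mem_image_of_mem _ (mem_pathComponent_self e₀)⟩
  exact noncompact_univ (EuclideanSpace ℝ (Fin m)) (huniv ▸ hcompact)
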